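/- **Notation.** For self-adjoint complex matrices $A=(A_1,\dots,A_N)$ of a fixed size and $n\in\mathbb N$, let $\mathcal D_A(n)$ be the set of $N$-tuples $X$ of self-adjoint complex $n\times n$ matrices with $\sum_{i} A_i\otimes X_i\le I\otimes I_n$; let $\mathcal D_A=\bigsqcup_n \mathcal D_A(n)$ be the free spectrahedron of $A$ (inclusions are levelwise), and for $s\in\mathbb R^N$ let $s\cdot\mathcal D_A=\{(s_1X_1,\dots,s_NX_N):X\in\mathcal D_A\}$. For $\mathbf k=(k_1,\dots,k_g)$, the matrix jewel $\mathcal D_{\mathbf k}$ is the free spectrahedron defined by the $\sum_{i=1}^g(k_i-1)$ matrices $$I^{\otimes(i-1)}\otimes \operatorname{diag}\big(v^{(k_i)}_j\big)\otimes I^{\otimes (g-i)},\qquad 1\le i\le g,\ 1\le j\le k_i-1,$$ where the $l$-th tensor factor has size $k_l\times k_l$ and $v^{(k)}_j(\epsilon)=-\frac2k+2\delta_{\epsilon,j}$ for $1\le\epsilon\le k$. For $k_1=\dots=k_g=2$ it is the matrix diamond. For $s\in\mathbb R^g$ write $$s^{(\mathbf k)}=(\underbrace{s_1,\dots,s_1}_{k_1-1},\dots,\underbrace{s_g,\dots,s_g}_{k_g-1})\in\mathbb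 R^{\sum_i(k_i-1)}.$$ The inclusion set $\Delta(g,d,\mathbf k)$ is the set of all $s\in\mathbb R^g$ with nonnegative entries such that, for every $\sum_i(k_i-1)$-tuple $B$ of self-adjoint complex $d\times d$ matrices, $$\mathcal D_{\mathbf k}(1)\subseteq\mathcal D_B(1)\ \Longrightarrow\ s^{(\mathbf k)}\cdot\mathcal D_{\mathbf k}\subseteq\mathcal D_B .$$ Finally, $\mathrm{QC}_N=\{t\in[0,1]^N:\sum_{i=1}^N t_i^2\le1\}$. **Theorem.** Let $g,d\in\mathbb N$, let $k_1,\dots,k_g\ge 2$ be integers, $\mathbf k=(k_1,\dots,k_g)$ and $N=\sum_{i=1}^g(k_i-1)$. For every $s\in\mathbb R^g$ such that $s^{(\mathbf k)}\in\Delta\big(N,d,(\underbrace{2,\dots,2}_{N})\big)$, $$\left(\frac{s_1}{(k_1-1)^2},\dots,\frac{s_g}{(k_g-1)^2}\right)\in\Delta(g,d,\mathbf k).$$ In particular, the same conclusion holds for every $s\in\mathbb R^g$ with $s^{(\mathbf k)}\in\mathrm{QC}_N$. -/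

import Mathlib

open scoped Kronecker ComplexOrder

/-- Level `n` of the free spectrahedron `𝒟_A`: all `X ∈ (M_n^{sa})^ι` with
`∑ i, A i ⊗ X i ≤ I ⊗ I`. -/
def freeSpectrahedron {ι m : Type} [Fintype ι] [DecidableEq m]
    (A : ι → Matrix m m ℂ) (n : ℕ) : Set (ι → Matrix (Fin n) (Fin n) ℂ) :=
  {X | (∀ i, (X i).IsHermitian) ∧
    ((1 : Matrix (m × Fin n) (m × Fin n) ℂ) - ∑ i, A i ⊗ₖ X i).PosSemidef}

/-- The entrywise scaling `s · S = {(s_i X_i)_i : X ∈ S}` of a set of matrix tuples. -/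
def scaleTuples {ι : Type} {n : ℕ} (s : ι → ℝ) (S : Set (ι → Matrix (Fin n) (Fin n) ℂ)) :
    Set (ι → Matrix (Fin n) (Fin n) ℂ) :=
  (fun X i => ((s i : ℝ) : ℂ) • X i) '' S

/-- The index set of a tuple `(X_{i,j})`, `1 ≤ i ≤ g`, `1 ≤ j ≤ k_i - 1`. -/
abbrev BlockIndex {g : ℕ} (k : Fin g → ℕ) : Type := Σ i : Fin g, Fin (k i - 1)

/-- The inclusion set of `𝒟_A` for a tuple `A` made of `g` groups of sizes `k_i - 1`: the
`s ∈ ℝ^g_+` such that, for every self-adjoint tuple `B` of `d × d` matrices,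
`𝒟_A(1) ⊆ 𝒟_B(1)` implies `(s_1^{×(k_1-1)}, …, s_g^{×(k_g-1)}) · 𝒟_A ⊆ 𝒟_B` at all levels. -/
def inclusionSet {g : ℕ} (k : Fin g → ℕ) {m : Type} [DecidableEq m]
    (A : BlockIndex k → Matrix m m ℂ) (d : ℕ) : Set (Fin g → ℝ) :=
  {s | (∀ i, 0 ≤ s i) ∧
    ∀ B : BlockIndex k → Matrix (Fin d) (Fin d) ℂ, (∀ p, (B p).IsHermitian) →
      freeSpectrahedron A 1 ⊆ freeSpectrahedron B 1 →
        ∀ n : ℕ, scaleTuples (fun p => s p.1) (freeSpectrahedron A n) ⊆ freeSpectrahedron B n}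

/-- The tensor product `M_1 ⊗ ⋯ ⊗ M_g` of square matrices, indexed by multi-indices. -/
def tensorMatrix {g : ℕ} {k : Fin g → ℕ} (M : ∀ i, Matrix (Fin (k i)) (Fin (k i)) ℂ) :
    Matrix (∀ i, Fin (k i)) (∀ i, Fin (k i)) ℂ :=
  Matrix.of fun a b => ∏ i, M i (a i) (b i)

/-- The vectors `v^{(k)}_j(ε) = -2/k + 2 δ_{ε,j}` for `1 ≤ j ≤ k - 1`, `1 ≤ ε ≤ k`
(numbered from `0` here). -/
noncomputable def jewelVector (k : ℕ) (j : Fin (k - 1)) (ε : Fin k) : ℂ :=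
  -2 / (k : ℂ) + 2 * (if (ε : ℕ) = (j : ℕ) then 1 else 0)

/-- The matrices `I ⊗ ⋯ ⊗ I ⊗ diag(v^{(k_i)}_j) ⊗ I ⊗ ⋯ ⊗ I` (diagonal factor in position `i`)
that define the matrix jewel. -/
noncomputable def jewelMatrix {g : ℕ} (k : Fin g → ℕ) (p : BlockIndex k) :
    Matrix (∀ i, Fin (k i)) (∀ i, Fin (k i)) ℂ :=
  tensorMatrix (Function.update (fun _ => 1) p.1 (Matrix.diagonal (jewelVector (k p.1) p.2)))

/-- `Δ(g, d, k)`: the inclusion set of the matrix jewel. The matrix jewel itself is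
`freeSpectrahedron (jewelMatrix k)`; for `k = (2, …, 2)` it is the matrix diamond. -/
noncomputable def jewelInclusionSet (g d : ℕ) (k : Fin g → ℕ) : Set (Fin g → ℝ) :=
  inclusionSet k (jewelMatrix k) d

/-- The vector `(s_1^{×(k_1-1)}, …, s_g^{×(k_g-1)})` of length `∑ (k_i - 1)`. -/
def blockRepeat {g : ℕ} (k : Fin g → ℕ) (s : Fin g → ℝ) : Fin (∑ i, (k i - 1)) → ℝ :=
  fun p => s (finSigmaFinEquiv.symm p).1

/-- The positive part `QC_N` of the Euclidean unit ball of `ℝ^N`. -/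
def QC (N : ℕ) : Set (Fin N → ℝ) :=
  {s | (∀ i, s i ∈ Set.Icc (0 : ℝ) 1) ∧ ∑ i, s i ^ 2 ≤ 1}

/-- The map `s ↦ (s_1 / (k_1-1)^2, …, s_g / (k_g-1)^2)`. -/
noncomputable def jewelScale {g : ℕ} (k : Fin g → ℕ) (s : Fin g → ℝ) : Fin g → ℝ :=
  fun i => 1 / ((k i : ℝ) - 1) ^ 2 * s i

/-! The jewel is compared with the diamond twice, at a cost of one factor per comparison. At level
one, the axis points `± k/(2(k-1))` lie in the jewel, so level-one inclusion makes `C = k/(2(k-1)) •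
B` a tuple of contractions; the scalar diamond is the l1 ball, so it lies in `freeSpectrahedron C
1`. At level `n`, every sign vector scaled blockwise by `2/(k(k-1))` is a convex combination of the
diagonals defining the jewel, so `Y = 2/(k(k-1)) • X` lies in the diamond. A scaling valid for the
diamond applies to `C` and `Y`, and the two factors multiply to `1/(k-1)^2`.

For `QC`, damped contractions are marginals of one positive family `G ε` summing to `1`. Then `1 - ∑
C i ⊗ s i X i` equals `∑ G ε ⊗ (1 - ∑ ± X i)`, a sum of positive terms. -/

namespace Matrix

/-! ### Kronecker products and positivity -/

theorem finset_sum_kronecker {κ l m n p : Type*} (t : Finset κ) (A : κ → Matrix l m ℂ)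
    (B : Matrix n p ℂ) : (∑ i ∈ t, A i) ⊗ₖ B = ∑ i ∈ t, A i ⊗ₖ B := by
  ext x y
  simp [sum_apply, Finset.sum_mul]

theorem kronecker_finset_sum {κ l m n p : Type*} (t : Finset κ) (A : Matrix l m ℂ)
    (B : κ → Matrix n p ℂ) : A ⊗ₖ (∑ i ∈ t, B i) = ∑ i ∈ t, A ⊗ₖ B i := by
  ext x y
  simp [sum_apply, Finset.mul_sum]

theorem PosSemidef.ofReal_smul {n : Type*} {M : Matrix n n ℂ} (hM : M.PosSemidef) {r : ℝ}
    (hr : 0 ≤ r) : ((r : ℂ) • M).PosSemidef :=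
  hM.smul (Complex.zero_le_real.2 hr)

/-- A Hermitian matrix between `-1` and `1` has square at most `1`. -/
theorem posSemidef_one_sub_mul_self {m : Type*} [Fintype m] [DecidableEq m] {C : Matrix m m ℂ}
    (h₁ : (1 - C).PosSemidef) (h₂ : (1 + C).PosSemidef) : (1 - C * C).PosSemidef := by
  -- The two conjugates add up to `2(1 - C²)`, since all factors commute.
  have a := h₁.conjTranspose_mul_mul_same (1 + C)
  have b := h₂.conjTranspose_mul_mul_same (1 - C)
  rw [h₂.1.eq] at a
  rw [h₁.1.eq] at b
  have := (a.add b).ofReal_smul (r := 1 / 2) (by norm_num)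
  convert this using 1
  have e : (1 + C) * (1 - C) * (1 + C) + (1 - C) * (1 + C) * (1 - C) = (2 : ℂ) • (1 - C * C) := by
    rw [two_smul]
    noncomm_ring
  rw [e, smul_smul]
  norm_num

/-- Block-diagonal matrices are positive semidefinite
exactly when their blocks are. -/
theorem posSemidef_one_sub_sum_diagonal_kronecker_iff {ι m n : Type*} [Fintype ι] [Fintype m]
    [DecidableEq m] [Fintype n] [DecidableEq n] (f : ι → m → ℂ) (X : ι → Matrix n n ℂ) :
    (1 - ∑ p, diagonal (f p) ⊗ₖ X p).PosSemidef ↔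
      ∀ a, (1 - ∑ p, f p a • X p).PosSemidef := by
  constructor
  · intro h a
    convert h.submatrix (fun j => (a, j)) using 1
    ext i j
    simp [sum_apply, one_apply]
  · intro h
    have : (1 - ∑ p, diagonal (f p) ⊗ₖ X p) =
        ∑ a, diagonal (fun c => if c = a then 1 else 0) ⊗ₖ (1 - ∑ p, f p a • X p) := by
      ext ⟨a, i⟩ ⟨b, j⟩
      by_cases hab : a = b
      · subst hab
        simp [sum_apply, one_apply]
      · simp [sum_apply, one_apply, hab]
    rw [this]
    refine posSemidef_sum _ fun a _ => PosSemidef.kronecker (PosSemidef.diagonal ?_) (h a)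
    intro c
    dsimp
    split_ifs <;> simp

end Matrix

open Matrix

/-! ### Sign averages and joint measurability -/

section Signs

variable {ι : Type*} [Fintype ι] [DecidableEq ι]

theorem sum_sign_eq_zero_of_odd {V : Type*} [AddCommGroup V] [Module ℂ V]
    (f : (ι → ℤˣ) → V) (hf : ∀ ε, f (-ε) = -f ε) : ∑ ε, f ε = 0 := by
  have h : ∑ ε, f ε = -∑ ε, f ε := by
    rw [← Finset.sum_neg_distrib, ← Equiv.sum_comp (Equiv.neg (ι → ℤˣ)) f]
    exact Finset.sum_congr rfl fun ε _ => hf ε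
  have h2 : (2 : ℂ) • ∑ ε, f ε = 0 := by
    rw [two_smul]
    exact eq_neg_iff_add_eq_zero.1 h
  simpa using h2

theorem sum_sign_mul_sign (i j : ι) :
    ∑ ε : ι → ℤˣ, (((ε i : ℤ) : ℂ) * ((ε j : ℤ) : ℂ)) =
      if i = j then (Fintype.card (ι → ℤˣ) : ℂ) else 0 := by
  split_ifs with h
  · subst h
    rw [Finset.sum_congr rfl fun ε _ => (?_ : _ = (1 : ℂ))]
    · simp
    · rcases Int.units_eq_one_or (ε i) with h | h <;> simp [h]
  -- Multiplying by `u` flips the sign at `i` and keeps the one at `j`, so the sum equals its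
  -- negative.
  · set u : ι → ℤˣ := Function.update 1 i (-1) with hu
    have hui : u i = -1 := by simp [hu]
    have huj : u j = 1 := by simp [hu, Function.update_of_ne (Ne.symm h)]
    have key : ∑ ε : ι → ℤˣ, (((ε i : ℤ) : ℂ) * ((ε j : ℤ) : ℂ)) =
        -∑ ε : ι → ℤˣ, (((ε i : ℤ) : ℂ) * ((ε j : ℤ) : ℂ)) := by
      rw [← Finset.sum_neg_distrib, ← Equiv.sum_comp (Equiv.mulLeft u)]
      refine Finset.sum_congr rfl fun ε _ => ?_
      simp [hui, huj]
    exact self_eq_neg.1 key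

/-- Dichotomic observables `C i`, damped by factors `s i` with `∑ (s i)² ≤ 1`, are jointly
measurable. -/
theorem exists_joint_measurement {m : Type*} [Fintype m] [DecidableEq m]
    (C : ι → Matrix m m ℂ) (h₁ : ∀ i, (1 - C i).PosSemidef) (h₂ : ∀ i, (1 + C i).PosSemidef)
    (hC : ∀ i, (C i).IsHermitian) (s : ι → ℝ) (hs : ∑ i, s i ^ 2 ≤ 1) :
    ∃ G : (ι → ℤˣ) → Matrix m m ℂ, (∀ ε, (G ε).PosSemidef) ∧ ∑ ε, G ε = 1 ∧
      ∀ i, ∑ ε : ι → ℤˣ, ((ε i : ℤ) : ℂ) • G ε = (s i : ℂ) • C i := by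
  set S : (ι → ℤˣ) → Matrix m m ℂ := fun ε => ∑ i, (((ε i : ℤ) : ℂ) * (s i : ℂ)) • C i with hS
  set Q : Matrix m m ℂ := ∑ i, ((s i ^ 2 : ℝ) : ℂ) • (C i * C i) with hQ
  set K : ℕ := Fintype.card (ι → ℤˣ) with hK
  have hK0 : (K : ℂ) ≠ 0 := by simp [hK]
  have Sneg : ∀ ε, S (-ε) = -S ε := fun ε => by
    simp [hS, ← Finset.sum_neg_distrib]
  have Sherm : ∀ ε, (S ε)ᴴ = S ε := fun ε => by
    simp only [hS, conjTranspose_sum]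
    refine Finset.sum_congr rfl fun i _ => ?_
    rw [conjTranspose_smul, (hC i).eq]
    simp
  have Qpos : (1 - Q).PosSemidef := by
    have e : 1 - Q = ((1 - ∑ i, s i ^ 2 : ℝ) : ℂ) • (1 : Matrix m m ℂ) +
        ∑ i, ((s i ^ 2 : ℝ) : ℂ) • (1 - C i * C i) := by
      simp only [hQ, smul_sub, Finset.sum_sub_distrib, ← Finset.sum_smul, Complex.ofReal_sub,
        Complex.ofReal_one, Complex.ofReal_sum, sub_smul, one_smul]
      abel
    rw [e]
    exact (PosSemidef.one.ofReal_smul (by linarith)).add (posSemidef_sum _ fun i _ =>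
      (posSemidef_one_sub_mul_self (h₁ i) (h₂ i)).ofReal_smul (sq_nonneg _))
  have sumS : ∑ ε, S ε = 0 := sum_sign_eq_zero_of_odd S Sneg
  have sumSi : ∀ i, ∑ ε : ι → ℤˣ, ((ε i : ℤ) : ℂ) • S ε = (K : ℂ) • (s i : ℂ) • C i := by
    intro i
    simp only [hS, Finset.smul_sum, smul_smul, ← mul_assoc]
    rw [Finset.sum_comm]
    simp only [← Finset.sum_smul, ← Finset.sum_mul, sum_sign_mul_sign]
    simp [hK, ite_mul, ite_smul]
  have sumSS : ∑ ε, S ε * S ε = (K : ℂ) • Q := by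
    have : ∀ ε, S ε * S ε = ∑ i, (s i : ℂ) • (C i * (((ε i : ℤ) : ℂ) • S ε)) := fun ε => by
      conv_lhs => enter [1]; rw [hS]
      simp only [Finset.sum_mul, smul_mul_assoc, mul_smul_comm, smul_smul]
      exact Finset.sum_congr rfl fun i _ => by rw [mul_comm]
    simp only [this]
    rw [Finset.sum_comm]
    simp only [← Finset.smul_sum, ← Finset.mul_sum, sumSi, hQ]
    rw [Finset.smul_sum]
    refine Finset.sum_congr rfl fun i _ => ?_
    simp only [mul_smul_comm, smul_smul, Complex.ofReal_pow]
    congr 1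
    ring
  have odd2 : ∀ i, ∑ ε : ι → ℤˣ, ((ε i : ℤ) : ℂ) • (2 - Q + S ε * S ε) = 0 := fun i =>
    sum_sign_eq_zero_of_odd _ fun ε => by simp [Sneg, add_comm]
  have expand : ∀ ε, (1 + S ε) * (1 + S ε) + (1 - Q) = (2 - Q + S ε * S ε) + (2 : ℂ) • S ε :=
    fun ε => by
      rw [two_smul, ← one_add_one_eq_two]
      noncomm_ring
  -- The square and `1 - Q` are both positive. In the expansion the even part `2 - Q + S²` sums to
  -- `2K`, because `S²` averages to `Q`; the odd part `2S` alone contributes to the signed sums,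
  -- giving `2K s i C i`.
  refine ⟨fun ε => ((1 / (2 * K) : ℝ) : ℂ) • ((1 + S ε) * (1 + S ε) + (1 - Q)), ?_, ?_, ?_⟩
  · intro ε
    refine (PosSemidef.add ?_ Qpos).ofReal_smul (by positivity)
    have := posSemidef_conjTranspose_mul_self (1 + S ε)
    rwa [conjTranspose_add, conjTranspose_one, Sherm] at this
  · simp only [expand]
    rw [← Finset.smul_sum, Finset.sum_add_distrib, ← Finset.smul_sum, sumS, smul_zero, add_zero,
      Finset.sum_add_distrib, sumSS]
    simp only [Finset.sum_const, Finset.card_univ, ← hK]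
    rw [← Nat.cast_smul_eq_nsmul ℂ, ← smul_add, sub_add_cancel, smul_smul,
      show (2 : Matrix m m ℂ) = (2 : ℂ) • 1 by rw [two_smul, one_add_one_eq_two], smul_smul]
    convert one_smul ℂ (1 : Matrix m m ℂ)
    push_cast
    field_simp
  · intro i
    simp only [expand, smul_comm _ ((1 / (2 * K) : ℝ) : ℂ)]
    rw [← Finset.smul_sum]
    simp only [smul_add (_ : ℂ) (2 - Q + _), Finset.sum_add_distrib, odd2]
    simp only [smul_comm _ (2 : ℂ)]
    rw [← Finset.smul_sum, sumSi, zero_add, smul_smul, smul_smul]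
    convert one_smul ℂ ((s i : ℂ) • C i)
    push_cast
    field_simp

/-- If all signed sums `∑ ± X i` are at most `1`, then `∑ s i • C i ⊗ X i ≤ 1` for Hermitian
contractions `C i` and `∑ (s i)² ≤ 1`. -/
theorem posSemidef_one_sub_sum_kronecker_of_sum_sq_le_one {m n : Type*} [Fintype m] [DecidableEq m]
    [Fintype n] [DecidableEq n]
    (C : ι → Matrix m m ℂ) (h₁ : ∀ i, (1 - C i).PosSemidef) (h₂ : ∀ i, (1 + C i).PosSemidef)
    (hC : ∀ i, (C i).IsHermitian) (s : ι → ℝ) (hs : ∑ i, s i ^ 2 ≤ 1) (X : ι → Matrix n n ℂ)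
    (hX : ∀ ε : ι → ℤˣ, (1 - ∑ i, ((ε i : ℤ) : ℂ) • X i).PosSemidef) :
    (1 - ∑ i, C i ⊗ₖ ((s i : ℂ) • X i)).PosSemidef := by
  obtain ⟨G, hG, hG1, hGs⟩ := exists_joint_measurement C h₁ h₂ hC s hs
  have e : 1 - ∑ i, C i ⊗ₖ ((s i : ℂ) • X i) =
      ∑ ε, G ε ⊗ₖ (1 - ∑ i, ((ε i : ℤ) : ℂ) • X i) := by
    have : ∀ i, C i ⊗ₖ ((s i : ℂ) • X i) = ∑ ε : ι → ℤˣ, G ε ⊗ₖ (((ε i : ℤ) : ℂ) • X i) := by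
      intro i
      rw [kronecker_smul, ← smul_kronecker, ← hGs, finset_sum_kronecker]
      simp only [smul_kronecker, kronecker_smul]
    simp only [this]
    rw [Finset.sum_comm]
    have h1 : (1 : Matrix (m × n) (m × n) ℂ) = ∑ ε, G ε ⊗ₖ (1 : Matrix n n ℂ) := by
      rw [← finset_sum_kronecker, hG1, one_kronecker_one]
    rw [h1, ← Finset.sum_sub_distrib]
    refine Finset.sum_congr rfl fun ε _ => ?_
    rw [← kronecker_finset_sum]
    ext x y
    simp [mul_sub]
  rw [e]
  exact posSemidef_sum _ fun ε _ => (hG ε).kronecker (hX ε)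

end Signs

/-! ### The two comparison estimates for the jewel -/

section Jewel

variable {g : ℕ} {k : Fin g → ℕ}

theorem jewelMatrix_eq_diagonal (p : BlockIndex k) :
    jewelMatrix k p = diagonal fun a => jewelVector (k p.1) p.2 (a p.1) := by
  ext a b
  obtain ⟨i, j⟩ := p
  have hrest : ∀ l ∈ Finset.univ.erase i,
      (Function.update (fun _ => 1) i (diagonal (jewelVector (k i) j)) :
        ∀ l, Matrix (Fin (k l)) (Fin (k l)) ℂ) l (a l) (b l) = if a l = b l then 1 else 0 := by
    intro l hl
    rw [Function.update_of_ne (Finset.ne_of_mem_erase hl), one_apply]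
  simp only [jewelMatrix, tensorMatrix, of_apply]
  rw [← Finset.mul_prod_erase _ _ (Finset.mem_univ i), Function.update_self,
    Finset.prod_congr rfl hrest]
  by_cases hab : a = b
  · subst hab
    simp
  · rw [diagonal_apply_ne _ hab]
    obtain ⟨l, hl⟩ := Function.ne_iff.1 hab
    by_cases hli : l = i
    · subst hli
      rw [diagonal_apply_ne _ hl, zero_mul]
    · rw [Finset.prod_eq_zero (Finset.mem_erase.2 ⟨hli, Finset.mem_univ l⟩) (if_neg hl), mul_zero]

theorem mem_freeSpectrahedron_jewelMatrix_iff {n : ℕ}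
    {X : BlockIndex k → Matrix (Fin n) (Fin n) ℂ} :
    X ∈ freeSpectrahedron (jewelMatrix k) n ↔ (∀ p, (X p).IsHermitian) ∧
      ∀ a : ∀ i, Fin (k i),
        (1 - ∑ p : BlockIndex k, jewelVector (k p.1) p.2 (a p.1) • X p).PosSemidef := by
  simp only [freeSpectrahedron, Set.mem_ofPred_eq, jewelMatrix_eq_diagonal,
    posSemidef_one_sub_sum_diagonal_kronecker_iff]

/-- Real form of `jewelVector`. -/
theorem jewelVector_eq_ofReal (k : ℕ) (j : Fin (k - 1)) (ε : Fin k) :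
    jewelVector k j ε = ((-2 / k + 2 * (if (ε : ℕ) = (j : ℕ) then 1 else 0) : ℝ) : ℂ) := by
  unfold jewelVector
  split_ifs <;> push_cast <;> rfl

theorem scalar_mem_freeSpectrahedron_one {ι m : Type} [Fintype ι] [Fintype m] [DecidableEq m]
    {B : ι → Matrix m m ℂ} {x : ι → ℝ}
    (h : (fun p => ((x p : ℝ) : ℂ) • (1 : Matrix (Fin 1) (Fin 1) ℂ)) ∈ freeSpectrahedron B 1) :
    (1 - ∑ p, ((x p : ℝ) : ℂ) • B p).PosSemidef := by
  convert h.2.submatrix (fun i => (i, 0)) using 1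
  ext i j
  simp [Matrix.sum_apply, one_apply, mul_comm]

/-- Level one inclusion, tested at points on the coordinate axes, bounds the norm of each `B p`. -/
theorem posSemidef_one_sub_smul_of_jewel_subset {d : ℕ}
    {B : BlockIndex k → Matrix (Fin d) (Fin d) ℂ}
    (hB : freeSpectrahedron (jewelMatrix k) 1 ⊆ freeSpectrahedron B 1) (p : BlockIndex k)
    (hk : 2 ≤ k p.1) (σ : ℝ) (hσ : |σ| ≤ 1) :
    (1 - ((σ * (k p.1 / (2 * ((k p.1 : ℝ) - 1))) : ℝ) : ℂ) • B p).PosSemidef := by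
  classical
  set t : ℝ := σ * (k p.1 / (2 * ((k p.1 : ℝ) - 1))) with ht
  set x : BlockIndex k → ℝ := Pi.single p t with hx
  have key : (1 - ∑ q, ((x q : ℝ) : ℂ) • B q).PosSemidef := by
    refine scalar_mem_freeSpectrahedron_one (hB ?_)
    rw [mem_freeSpectrahedron_jewelMatrix_iff]
    refine ⟨fun q => ?_, fun a => ?_⟩
    · rw [IsHermitian, conjTranspose_smul, conjTranspose_one, Complex.star_def, Complex.conj_ofReal]
    · set r : ℝ := (-2 / k p.1 + 2 * (if (a p.1 : ℕ) = (p.2 : ℕ) then 1 else 0) : ℝ) with hr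
      have e : (1 - ∑ q : BlockIndex k, jewelVector (k q.1) q.2 (a q.1) •
          ((x q : ℝ) : ℂ) • (1 : Matrix (Fin 1) (Fin 1) ℂ)) =
          ((1 - r * t : ℝ) : ℂ) • (1 : Matrix (Fin 1) (Fin 1) ℂ) := by
        rw [Finset.sum_eq_single p]
        · rw [jewelVector_eq_ofReal, ← hr, hx, Pi.single_eq_same, smul_smul]
          push_cast
          rw [sub_smul, one_smul]
        · intro q _ hq
          simp [hx, Pi.single_eq_of_ne hq]
        · simp
      rw [e]
      refine PosSemidef.one.ofReal_smul ?_
      have hk' : (2 : ℝ) ≤ k p.1 := by exact_mod_cast hk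
      -- The product is `k - 1` over `k - 1` on the `j`-th entry and `-1/(k-1)` elsewhere; the
      -- second bound needs `k ≥ 2`.
      have hr' : |r * (k p.1 / (2 * ((k p.1 : ℝ) - 1)))| ≤ 1 := by
        have : r * (k p.1 / (2 * ((k p.1 : ℝ) - 1))) =
            (-1 + k p.1 * (if (a p.1 : ℕ) = (p.2 : ℕ) then 1 else 0)) / ((k p.1 : ℝ) - 1) := by
          have : (k p.1 : ℝ) - 1 ≠ 0 := by linarith
          rw [hr]
          field_simp
        rw [this, abs_le, le_div_iff₀ (by linarith), div_le_iff₀ (by linarith)]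
        split_ifs <;> constructor <;> linarith
      have : r * t ≤ 1 := by
        rw [ht, mul_left_comm]
        refine (le_abs_self _).trans ?_
        rw [abs_mul]
        exact mul_le_one₀ hσ (abs_nonneg _) hr'
      linarith
  convert key using 2
  rw [Finset.sum_eq_single p]
  · simp [hx]
  · intro q _ hq
    simp [hx, Pi.single_eq_of_ne hq]
  · simp

/-- Product weights have the `w i` as marginals; this lets the blocks be averaged independently. -/
theorem sum_pi_prod_mul_apply {g : ℕ} {k : Fin g → ℕ} (w : ∀ i, Fin (k i) → ℝ)
    (hw : ∀ i, ∑ ε, w i ε = 1) (i : Fin g) (f : Fin (k i) → ℝ) :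
    ∑ a : ∀ i, Fin (k i), (∏ l, w l (a l)) * f (a i) = ∑ ε, w i ε * f ε := by
  have h := Finset.prod_univ_sum (fun l => (Finset.univ : Finset (Fin (k l))))
    (Function.update w i fun ε => w i ε * f ε)
  rw [Fintype.piFinset_univ] at h
  rw [← Finset.mul_prod_erase _ _ (Finset.mem_univ i), Function.update_self,
    Finset.prod_congr rfl (g := fun _ => 1) (fun l hl => by
      rw [Function.update_of_ne (Finset.ne_of_mem_erase hl), hw]), Finset.prod_const_one,
    mul_one] at h
  rw [h]
  refine Finset.sum_congr rfl fun a _ => ?_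
  rw [← Finset.mul_prod_erase _ _ (Finset.mem_univ i),
    ← Finset.mul_prod_erase _ _ (Finset.mem_univ i), Function.update_self,
    mul_right_comm]
  congr 1
  exact Finset.prod_congr rfl fun l hl => by
    rw [Function.update_of_ne (Finset.ne_of_mem_erase hl)]

/-- The points `2 σ / (k (k - 1))`, for signs `σ`, are convex combinations of the vectors
`ε ↦ v(ε)`. -/
theorem exists_jewel_weights {k : ℕ} (hk : 2 ≤ k) (σ : Fin (k - 1) → ℝ) (hσ : ∀ j, |σ j| ≤ 1) :
    ∃ w : Fin k → ℝ, (∀ ε, 0 ≤ w ε) ∧ ∑ ε, w ε = 1 ∧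
      ∀ j : Fin (k - 1), ∑ ε, w ε * (-2 / k + 2 * (if (ε : ℕ) = (j : ℕ) then 1 else 0)) =
        2 / (k * ((k : ℝ) - 1)) * σ j := by
  obtain ⟨n, rfl⟩ : ∃ n, k = n + 1 := ⟨k - 1, by omega⟩
  change Fin n → ℝ at σ
  change ∀ j : Fin n, |σ j| ≤ 1 at hσ
  have hn : (1 : ℝ) ≤ n := by exact_mod_cast (by omega : 1 ≤ n)
  -- With total mass one, the required mean is `-2/k + 2 w j`; this is its solution for `w j`, with
  -- `k = n + 1`. The last index, where no `δ` is active, takes the remaining mass.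
  set v : Fin n → ℝ := fun j => 1 / (n + 1) + σ j / ((n + 1) * n) with hv
  have hv0 : ∀ j, 0 ≤ v j := fun j => by
    have : v j = (n + σ j) / ((n + 1) * n) := by
      rw [hv]
      field_simp
    rw [this]
    have := (abs_le.1 (hσ j)).1
    exact div_nonneg (by linarith) (by positivity)
  have hv1 : ∑ j, v j ≤ 1 := by
    have hs : ∑ j, σ j ≤ n := by
      calc ∑ j, σ j ≤ ∑ _j : Fin n, (1 : ℝ) := Finset.sum_le_sum fun j _ => (abs_le.1 (hσ j)).2
        _ = n := by simp
    have : ∑ j, v j = (n * n + ∑ j, σ j) / ((n + 1) * n) := by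
      simp only [hv, Finset.sum_add_distrib, ← Finset.sum_div, Finset.sum_const,
        Finset.card_univ, Fintype.card_fin, nsmul_eq_mul]
      field_simp
    rw [this, div_le_one (by positivity)]
    linarith
  refine ⟨Fin.snoc v (1 - ∑ j, v j), ?_, ?_, ?_⟩
  · intro ε
    refine Fin.lastCases ?_ (fun j => ?_) ε
    · simpa using hv1
    · simpa using hv0 j
  · rw [Fin.sum_univ_castSucc]
    simp
  · change ∀ j : Fin n, _
    intro j
    rw [Fin.sum_univ_castSucc]
    have hj : (n : ℕ) ≠ j := j.2.ne'
    have hsum : ∑ x : Fin n, v x * (-2 / ((n + 1 : ℕ) : ℝ) +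
        2 * (if (x : ℕ) = (j : ℕ) then 1 else 0)) =
        (∑ x, v x) * (-2 / ((n + 1 : ℕ) : ℝ)) + 2 * v j := by
      simp only [mul_add, Finset.sum_add_distrib, ← Finset.sum_mul]
      congr 1
      rw [Finset.sum_eq_single j]
      · simp [mul_comm]
      · intro x _ hx
        simp [Fin.val_ne_of_ne hx]
      · simp
    simp only [Fin.snoc_castSucc, Fin.snoc_last, Fin.val_castSucc, Fin.val_last, hj, if_false]
    rw [hsum, mul_zero, add_zero, add_right_comm, ← add_mul, add_sub_cancel, hv]
    have hn0 : (n : ℝ) ≠ 0 := by linarith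
    push_cast
    rw [add_sub_cancel_right]
    field_simp
    ring

/-- Averaging the diagonal blocks of the jewel inequality with the product of the blockwise weights
produces exactly these coefficients. -/
theorem posSemidef_one_sub_signed_sum_of_mem_jewel (hk : ∀ i, 2 ≤ k i) {n : ℕ}
    {X : BlockIndex k → Matrix (Fin n) (Fin n) ℂ} (hX : X ∈ freeSpectrahedron (jewelMatrix k) n)
    (σ : BlockIndex k → ℝ) (hσ : ∀ p, |σ p| ≤ 1) :
    (1 - ∑ p : BlockIndex k,
      ((2 / (k p.1 * ((k p.1 : ℝ) - 1)) * σ p : ℝ) : ℂ) • X p).PosSemidef := by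
  rw [mem_freeSpectrahedron_jewelMatrix_iff] at hX
  choose w hw0 hw1 hw using fun i =>
    exists_jewel_weights (hk i) (fun j => σ ⟨i, j⟩) (fun j => hσ ⟨i, j⟩)
  have e : (1 - ∑ p : BlockIndex k,
      ((2 / (k p.1 * ((k p.1 : ℝ) - 1)) * σ p : ℝ) : ℂ) • X p) =
      ∑ a : ∀ i, Fin (k i), ((∏ l, w l (a l) : ℝ) : ℂ) •
        (1 - ∑ p : BlockIndex k, jewelVector (k p.1) p.2 (a p.1) • X p) := by
    simp only [smul_sub, Finset.sum_sub_distrib, ← Finset.sum_smul, Finset.smul_sum, smul_smul]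
    congr 1
    · rw [← Complex.ofReal_sum, ← Fintype.piFinset_univ, ← Finset.prod_univ_sum]
      simp [hw1]
    · rw [Finset.sum_comm]
      refine Finset.sum_congr rfl fun p _ => ?_
      rw [← Finset.sum_smul]
      simp only [jewelVector_eq_ofReal, ← Complex.ofReal_mul, ← Complex.ofReal_sum]
      rw [sum_pi_prod_mul_apply w hw1 p.1
        (fun ε => -2 / (k p.1 : ℝ) + 2 * (if (ε : ℕ) = (p.2 : ℕ) then 1 else 0)), hw]
  rw [e]
  exact posSemidef_sum _ fun a _ =>
    (hX.2 a).ofReal_smul (Finset.prod_nonneg fun i _ => hw0 i _)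

end Jewel

/-! ### Transfer between diamond and jewel -/

section Diamond

variable {N : ℕ}

theorem diamond_one_subset_of_contraction {d : ℕ}
    {C : BlockIndex (fun _ : Fin N => 2) → Matrix (Fin d) (Fin d) ℂ}
    (h₁ : ∀ p, (1 - C p).PosSemidef) (h₂ : ∀ p, (1 + C p).PosSemidef) :
    freeSpectrahedron (jewelMatrix fun _ : Fin N => 2) 1 ⊆ freeSpectrahedron C 1 := by
  intro X hX
  refine ⟨hX.1, ?_⟩
  set x : BlockIndex (fun _ : Fin N => 2) → ℝ := fun p => (X p 0 0).re with hx
  have hXx : ∀ p, X p 0 0 = (x p : ℂ) := fun p => ((hX.1 p).coe_re_apply_self 0).symm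
  have hsum : 0 ≤ 1 - ∑ p, |x p| := by
    -- Signs of the coordinates turn the signed sum into the l1 norm. As `sign 0 = 0`, coefficients
    -- in `[-1, 1]` are needed, not only `±1`.
    have h := posSemidef_one_sub_signed_sum_of_mem_jewel (fun _ => le_rfl) hX
      (fun p => SignType.sign (x p)) fun p => by
        rcases lt_trichotomy (x p) 0 with h | h | h <;> simp [h]
    have h0 := h.diag_nonneg (i := 0)
    rw [← Complex.zero_le_real]
    convert h0 using 1
    simp only [Matrix.sub_apply, one_apply_eq, Matrix.sum_apply, Matrix.smul_apply, hXx, smul_eq_mul,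
      ← Complex.ofReal_mul, ← Complex.ofReal_sum, ← Complex.ofReal_one, ← Complex.ofReal_sub]
    congr 2
    refine Finset.sum_congr rfl fun p _ => ?_
    rw [← sign_mul_self]
    norm_num
  have key : (1 - ∑ p, (x p : ℂ) • C p).PosSemidef := by
    have e : 1 - ∑ p, (x p : ℂ) • C p = ((1 - ∑ p, |x p| : ℝ) : ℂ) • (1 : Matrix _ _ ℂ) +
        ∑ p, (((|x p| : ℝ) : ℂ) • (1 : Matrix _ _ ℂ) - (x p : ℂ) • C p) := by
      rw [Finset.sum_sub_distrib, ← Finset.sum_smul, Complex.ofReal_sub, Complex.ofReal_sum,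
        sub_smul, Complex.ofReal_one, one_smul]
      abel
    rw [e]
    refine (PosSemidef.one.ofReal_smul hsum).add (posSemidef_sum _ fun p _ => ?_)
    rcases le_total 0 (x p) with h | h
    · rw [abs_of_nonneg h, ← smul_sub]
      exact (h₁ p).ofReal_smul h
    · convert (h₂ p).ofReal_smul (neg_nonneg.2 h) using 1
      rw [abs_of_nonpos h, smul_add, Complex.ofReal_neg, neg_smul, neg_smul]
      abel
  convert key.submatrix Prod.fst using 1
  ext ⟨i, a⟩ ⟨j, b⟩
  rw [Subsingleton.elim a 0, Subsingleton.elim b 0]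
  simp [Matrix.sum_apply, one_apply, hXx, mul_comm]

theorem mem_diamond_of_signed_sums {n : ℕ}
    {Y : BlockIndex (fun _ : Fin N => 2) → Matrix (Fin n) (Fin n) ℂ} (hY : ∀ p, (Y p).IsHermitian)
    (h : ∀ σ : BlockIndex (fun _ : Fin N => 2) → ℝ, (∀ p, |σ p| ≤ 1) →
      (1 - ∑ p, (σ p : ℂ) • Y p).PosSemidef) :
    Y ∈ freeSpectrahedron (jewelMatrix fun _ : Fin N => 2) n := by
  rw [mem_freeSpectrahedron_jewelMatrix_iff]
  refine ⟨hY, fun a => ?_⟩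
  simp only [jewelVector_eq_ofReal]
  -- For `k = 2` the entries of the defining vector are `±1`.
  refine h (fun p => -2 / (2 : ℕ) + 2 * (if (a p.1 : ℕ) = (p.2 : ℕ) then 1 else 0)) fun p => ?_
  split_ifs <;> norm_num

theorem QC_subset_jewelInclusionSet (N d : ℕ) :
    QC N ⊆ jewelInclusionSet N d fun _ => 2 := by
  rintro s ⟨hs, hs2⟩
  refine ⟨fun i => (hs i).1, fun B hB hsub n => ?_⟩
  rintro _ ⟨X, hX, rfl⟩
  -- Both comparison factors equal `1` at `k = 2`, so nothing is lost for the diamond.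
  have hC : ∀ p (σ : ℝ), |σ| ≤ 1 → (1 - (σ : ℂ) • B p).PosSemidef := fun p σ hσ => by
    convert posSemidef_one_sub_smul_of_jewel_subset hsub p le_rfl σ hσ using 4
    norm_num
  refine ⟨fun p => ?_, ?_⟩
  · rw [IsHermitian, conjTranspose_smul, (hX.1 p).eq, Complex.star_def, Complex.conj_ofReal]
  refine posSemidef_one_sub_sum_kronecker_of_sum_sq_le_one B (fun p => ?_) (fun p => ?_) hB
    (fun p => s p.1) ?_ X fun ε => ?_
  · simpa using hC p 1 (by simp)
  · simpa using hC p (-1) (by simp)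
  · rw [Fintype.sum_sigma]
    simpa using hs2
  · convert posSemidef_one_sub_signed_sum_of_mem_jewel (fun _ => le_rfl) hX
      (fun p => ((ε p : ℤ) : ℝ)) (fun p => ?_) using 5
    · norm_num
    · rcases Int.units_eq_one_or (ε p) with h | h <;> simp [h]

/-- The blocks of a jewel, enumerated as the coordinates of a diamond. -/
def diamondIndexEquiv {g : ℕ} (k : Fin g → ℕ) :
    BlockIndex (fun _ : Fin (∑ i, (k i - 1)) => 2) ≃ BlockIndex k where
  toFun q := finSigmaFinEquiv.symm q.1
  invFun p := ⟨finSigmaFinEquiv p, (0 : Fin 1)⟩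
  left_inv _ := Sigma.ext (Equiv.apply_symm_apply _ _)
    (heq_of_eq (Subsingleton.elim (α := Fin 1) _ _))
  right_inv _ := Equiv.symm_apply_apply _ _

theorem jewelScale_mem_jewelInclusionSet {g d : ℕ} {k : Fin g → ℕ} (hk : ∀ i, 2 ≤ k i)
    {s : Fin g → ℝ}
    (hs : blockRepeat k s ∈ jewelInclusionSet (∑ i, (k i - 1)) d fun _ => 2) :
    jewelScale k s ∈ jewelInclusionSet g d k := by
  obtain ⟨hs0, hs⟩ := hs
  have hk' : ∀ i, (2 : ℝ) ≤ k i := fun i => by exact_mod_cast hk i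
  refine ⟨fun i => ?_, fun B hB hsub n => ?_⟩
  -- Since `k i ≥ 2`, block `i` is nonempty and `s i` does occur in the repeated vector.
  · have h := hs0 (finSigmaFinEquiv ⟨i, ⟨0, by have := hk i; omega⟩⟩)
    rw [blockRepeat, Equiv.symm_apply_apply] at h
    exact mul_nonneg (by positivity) h
  rintro _ ⟨X, hX, rfl⟩
  refine ⟨fun p => ?_, ?_⟩
  · rw [IsHermitian, conjTranspose_smul, (hX.1 p).eq, Complex.star_def, Complex.conj_ofReal]
  set e := diamondIndexEquiv k with he
  -- `b` is the level-one factor moved onto `B`, `c` the level-`n` factor moved onto `X`; `b * c =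
  -- 1/(k-1)^2`.
  set b : BlockIndex k → ℝ := fun p => k p.1 / (2 * ((k p.1 : ℝ) - 1)) with hb
  set c : BlockIndex k → ℝ := fun p => 2 / (k p.1 * ((k p.1 : ℝ) - 1)) with hc
  set C : BlockIndex (fun _ : Fin (∑ i, (k i - 1)) => 2) → Matrix (Fin d) (Fin d) ℂ :=
    fun q => (b (e q) : ℂ) • B (e q) with hC
  set Y : BlockIndex (fun _ : Fin (∑ i, (k i - 1)) => 2) → Matrix (Fin n) (Fin n) ℂ :=
    fun q => (c (e q) : ℂ) • X (e q) with hY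
  have hCσ : ∀ q (σ : ℝ), |σ| ≤ 1 → (1 - (σ : ℂ) • C q).PosSemidef := fun q σ hσ => by
    have := posSemidef_one_sub_smul_of_jewel_subset hsub (e q) (hk _) σ hσ
    rwa [Complex.ofReal_mul, mul_smul] at this
  have hCsub := diamond_one_subset_of_contraction (C := C)
    (fun q => by simpa using hCσ q 1 (by simp)) (fun q => by simpa using hCσ q (-1) (by simp))
  have hYmem : Y ∈ freeSpectrahedron (jewelMatrix fun _ => 2) n := by
    refine mem_diamond_of_signed_sums (fun q => ?_) fun σ hσ => ?_
    · rw [IsHermitian, conjTranspose_smul, (hX.1 _).eq, Complex.star_def, Complex.conj_ofReal]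
    · convert posSemidef_one_sub_signed_sum_of_mem_jewel hk hX (fun p => σ (e.symm p))
        (fun p => hσ _) using 2
      rw [← Equiv.sum_comp e]
      refine Finset.sum_congr rfl fun q _ => ?_
      rw [Equiv.symm_apply_apply, mul_comm, Complex.ofReal_mul, mul_smul]
  have hCherm : ∀ q, (C q).IsHermitian := fun q => by
    rw [IsHermitian, conjTranspose_smul, (hB _).eq, Complex.star_def, Complex.conj_ofReal]
  have h := (hs C hCherm hCsub n ⟨Y, hYmem, rfl⟩).2
  convert h using 2
  rw [← Equiv.sum_comp e]
  refine Finset.sum_congr rfl fun q _ => ?_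
  simp only [hC, hY, kronecker_smul, smul_kronecker, smul_smul, ← Complex.ofReal_mul]
  congr 2
  have h1 : blockRepeat k s q.1 = s (e q).1 := rfl
  have h2 := hk' (e q).1
  have h3 : (k (e q).1 : ℝ) - 1 ≠ 0 := by linarith
  have h4 : (k (e q).1 : ℝ) ≠ 0 := by linarith
  rw [h1, hb, hc, jewelScale]
  field_simp

end Diamond

theorem mainTheorem4 (g d : ℕ) (k : Fin g → ℕ) (hk : ∀ i, 2 ≤ k i) :
    jewelScale k '' {s | blockRepeat k s ∈
        jewelInclusionSet (∑ i, (k i - 1)) d (fun _ => 2)} ⊆ jewelInclusionSet g d k ∧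
    jewelScale k '' {s | blockRepeat k s ∈ QC (∑ i, (k i - 1))} ⊆ jewelInclusionSet g d k := by
  constructor
  · rintro _ ⟨s, hs, rfl⟩
    exact jewelScale_mem_jewelInclusionSet hk hs
  · rintro _ ⟨s, hs, rfl⟩
    exact jewelScale_mem_jewelInclusionSet hk (QC_subset_jewelInclusionSet _ d hs)
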